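/- Setting. Let $\mathcal U=\{1,\dots,K\}$ be a finite set of controls and $\mu$ a measure on $\mathbb R$. For each $u\in\mathcal U$ let $\Psi_u\subset\mathbb R$ and let $p(y;\theta,u)=h_u(y)\exp(\theta T_u(y)-A_u(\theta))$, $\theta\in\Psi_u$, be a single-parameter exponential family of probability densities with respect to $\mu$, where $A_u(\theta)=\log\int h_u e^{\theta T_u}\,d\mu$. Let $\Theta_1,\dots,\Theta_M\subset\Psi_1\times\dots\times\Psi_K$ be pairwise disjoint, and for $\bm\theta\in\bigcup_m\Theta_m$ let $g(\bm\theta)$ be the index $m$ with $\bm\theta\in\Theta_m$. At each time $k=1,2,\dots$ a control $U_k$ is chosen and an observation $Y_k$ is made; let $\mathcal F_n=\sigma(U_1,Y_1,\dots,U_n,Y_n)$. A policy consists of controls $U_n$ that are $\mathcal F_{n-1}$-measurable, a stopping time $\tau$ of $(\mathcal F_n)_{n\ge0}$ and an $\mathcal F_\tau$-measurable decision $\hat m\in\{1,\dots,M\}$; under $\mathbb P_{\bm\theta}$, $\bm\theta\in\bigcup_m\Theta_m$, the conditional distribution of $Y_n$ given $\mathcal F_{n-1}$ has density $p(\cdot;\theta_{U_n},U_n)$.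 The policy is $\bar\alpha$-correct if, for every $\bm\theta\in\bigcup_m\Theta_m$, $\mathbb P_{\bm\theta}[\tau<\infty]=1$ and $\mathbb P_{\bm\theta}[\hat m\ne g(\bm\theta)]\le\alpha$. Let $D_u(\bm\theta\|\bm\theta')\in[0,\infty]$ be the Kullback--Leibler divergence of the law with density $p(\cdot;\theta_u,u)$ from the law with density $p(\cdot;\theta'_u,u)$, let $d(x\|y)=x\log\frac xy+(1-x)\log\frac{1-x}{1-y}$, and $$D^*(\bm\theta)=\sup_{q}\ \inf_{\bm\theta'\in\bigcup_m\Theta_m\setminus\Theta_{g(\bm\theta)}}\ \sum_{u\in\mathcal U}q_uD_u(\bm\theta\|\bm\theta')\in[0,\infty],$$ the supremum being over all probability distributions $q$ on $\mathcal U$ (with $\inf\emptyset=\infty$, $0\cdot\infty=0$). Lemma 1. Let $\bm\theta\in\bigcup_m\Theta_m$. (i) For every $\alpha\in(0,1/2]$, every $\bar\alpha$-correct policy satisfies $$\mathbb E_{\bm\theta}[\tau]\ \ge\ \frac{d(\alpha\|1-\alpha)}{D^*(\bm\theta)}$$ (in $[0,\infty]$, with $x/\infty=0$, $x/0=\infty$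 for $x>0$ and $0/0=0$). (ii) Consequently, for every family of policies, with stopping times $\tau_\alpha$, of which the one with index $\alpha$ is $\bar\alpha$-correct for all sufficiently small $\alpha>0$, $$\liminf_{\alpha\to0^+}\frac{\mathbb E_{\bm\theta}[\tau_\alpha]}{|\log\alpha|}\ \ge\ \frac1{D^*(\bm\theta)}.$$ -/

import Mathlib

open MeasureTheory ProbabilityTheory Filter Topology
open scoped ENNReal

namespace ControlledSensing

/-- A composite multihypothesis controlled sensing problem with `K` controls and `M` hypotheses.
Under control `u` the observation has, with respect to the common measure `base`, a density
`h u y * exp (t * T u y - A u t)` from a single-parameter exponential family with parameter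
`t ∈ Ψ u`. The state of nature is a vector `θ ∈ Ψ 1 × ... × Ψ K`, and hypothesis `m` says that
`θ ∈ Θ m`. -/
structure Problem (K M : ℕ) where
  /-- the common dominating measure -/
  base : Measure ℝ
  /-- the carrier density of the family of control `u` -/
  h : Fin K → ℝ → ℝ
  /-- the statistic of the family of control `u` -/
  T : Fin K → ℝ → ℝ
  /-- the set of admissible parameters of control `u` -/
  Ψ : Fin K → Set ℝ
  measurable_h : ∀ u, Measurable (h u)
  measurable_T : ∀ u, Measurable (T u)
  h_nonneg : ∀ u y, 0 ≤ h u y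
  /-- every admissible parameter has a finite normalizing constant ... -/
  integrable_exp : ∀ u, ∀ t ∈ Ψ u, Integrable (fun y => h u y * Real.exp (t * T u y)) base
  /-- ... which is positive -/
  integral_exp_pos : ∀ u, ∀ t ∈ Ψ u, 0 < ∫ y, h u y * Real.exp (t * T u y) ∂base
  /-- the hypothesis sets -/
  Θ : Fin M → Set (Fin K → ℝ)
  Θ_subset : ∀ m, Θ m ⊆ Set.univ.pi Ψ
  Θ_disjoint : ∀ m m', m ≠ m' → Disjoint (Θ m) (Θ m')

namespace Problem

variable {K M : ℕ} (S : Problem K M)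

/-- The log-partition function `A u` of the family of control `u`. -/
noncomputable def logPartition (u : Fin K) (t : ℝ) : ℝ :=
  Real.log (∫ y, S.h u y * Real.exp (t * S.T u y) ∂S.base)

/-- The density `p (y; θ, u)`. -/
noncomputable def density (θ : Fin K → ℝ) (u : Fin K) (y : ℝ) : ℝ :=
  S.h u y * Real.exp (θ u * S.T u y - S.logPartition u (θ u))

/-- The distribution of an observation under control `u` when the state of nature is `θ`. -/
noncomputable def obsLaw (θ : Fin K → ℝ) (u : Fin K) : Measure ℝ :=
  S.base.withDensity (fun y => ENNReal.ofReal (S.density θ u y))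

/-- The Kullback-Leibler divergence `D_u (θ ‖ θ')`. -/
noncomputable def divergence (u : Fin K) (θ θ' : Fin K → ℝ) : ℝ≥0∞ :=
  InformationTheory.klDiv (S.obsLaw θ u) (S.obsLaw θ' u)

/-- The union of all hypothesis sets. -/
def states : Set (Fin K → ℝ) := ⋃ m, S.Θ m

/-- The union of all hypothesis sets minus the one that contains `θ`. -/
def alternatives (θ : Fin K → ℝ) : Set (Fin K → ℝ) :=
  {θ' | θ' ∈ S.states ∧ ∀ m, θ ∈ S.Θ m → θ' ∉ S.Θ m}

/-- `D^* (θ)`: the supremum over all distributions `q` on the controls of the infimum over all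
alternatives `θ'` of `∑ u, q u * D_u (θ ‖ θ')`, as an extended nonnegative real
(`⊤` if there are no alternatives). -/
noncomputable def Dstar (θ : Fin K → ℝ) : ℝ≥0∞ :=
  ⨆ q ∈ stdSimplex ℝ (Fin K), ⨅ θ' ∈ S.alternatives θ,
    ∑ u, ENNReal.ofReal (q u) * S.divergence u θ θ'

end Problem

/-- `history U Y hU hY n` is the σ-algebra generated by the first `n` controls and observations
`U 0, Y 0, ..., U (n - 1), Y (n - 1)`. -/
def history {K : ℕ} {Ω : Type*} [mΩ : MeasurableSpace Ω] (U : ℕ → Ω → Fin K) (Y : ℕ → Ω → ℝ)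
    (hU : ∀ k, Measurable (U k)) (hY : ∀ k, Measurable (Y k)) : Filtration ℕ mΩ where
  seq n := ⨆ k, ⨆ _ : k < n,
    MeasurableSpace.comap (U k) inferInstance ⊔ MeasurableSpace.comap (Y k) inferInstance
  mono' _ _ hij := iSup_mono fun _ => iSup_mono' fun hk => ⟨lt_of_lt_of_le hk hij, le_rfl⟩
  le' _ := iSup_le fun k => iSup_le fun _ => sup_le (hU k).comap_le (hY k).comap_le

/-- A policy `({U_n}, τ, m̂)` for the problem `S`, together with the probability space on which it
runs and the probability measures `prob θ`, one for each state of nature `θ`. Time steps are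
counted from `0`, so that `U k` and `Y k` are the control and the observation number `k + 1`. -/
structure Policy {K M : ℕ} (S : Problem K M) where
  Ω : Type*
  mΩ : MeasurableSpace Ω
  /-- the probability measure when the state of nature is `θ` -/
  prob : (Fin K → ℝ) → Measure Ω
  isProb : ∀ θ ∈ S.states, IsProbabilityMeasure (prob θ)
  /-- the controls -/
  U : ℕ → Ω → Fin K
  /-- the observations -/
  Y : ℕ → Ω → ℝ
  measurable_U : ∀ k, Measurable (U k)
  measurable_Y : ∀ k, Measurable (Y k)
  /-- the next control is a function of the past controls and observations -/
  predictable : ∀ k, Measurable[history U Y measurable_U measurable_Y k] (U k)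
  /-- given the past (and hence the current control `u`), the observation has
  density `p (·; θ, u)` -/
  law : ∀ θ ∈ S.states, ∀ k, ∀ B : Set ℝ, MeasurableSet B →
    (prob θ)⟦Y k ⁻¹' B | history U Y measurable_U measurable_Y k⟧
      =ᵐ[prob θ] fun ω => (S.obsLaw θ (U k ω)).real B
  /-- the stopping time: the number of observations taken -/
  τ : Ω → ℕ∞
  isStoppingTime : IsStoppingTime (history U Y measurable_U measurable_Y) τ
  /-- the decision -/
  decision : Ω → Fin M
  measurable_decision : Measurable[isStoppingTime.measurableSpace] decision

namespace Policy

variable {K M : ℕ} {S : Problem K M}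

/-- `α`-correctness: under every state of nature the policy stops almost surely, and its decision
is wrong with probability at most `α`. -/
def IsCorrect (φ : Policy S) (α : ℝ) : Prop :=
  ∀ m, ∀ θ ∈ S.Θ m,
    φ.prob θ {ω | φ.τ ω < ⊤} = 1 ∧ φ.prob θ {ω | φ.decision ω ≠ m} ≤ ENNReal.ofReal α

/-- The expected delay `E_θ [τ]`. -/
noncomputable def expectedDelay (φ : Policy S) (θ : Fin K → ℝ) : ℝ≥0∞ :=
  letI := φ.mΩ
  ∫⁻ ω, (φ.τ ω : ℝ≥0∞) ∂φ.prob θ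

end Policy

/-- The binary relative entropy `d (x ‖ y)`. -/
noncomputable def binaryRelEntropy (x y : ℝ) : ℝ :=
  x * Real.log (x / y) + (1 - x) * Real.log ((1 - x) / (1 - y))

end ControlledSensing

/-! Compare `θ` with an alternative `θ'`. The event that the decision is wrong for `θ` has
probability at most `α` under `θ`, and its complement has probability at most `α` under `θ'`. So the
log-likelihood ratio accumulated up to `τ` has mean at least d(α‖1-α) under `θ`
(`binaryRelEntropy_le_integral`). It contains only observation terms, because the controls are
predictable and hence chosen alike under both states (`measure_eq_setLIntegral_exp_stopped`). By
Wald's identity (`integral_cumulative_toNat`) its mean is ∑ N_u D_u(θ‖θ'), where N_u is the expected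
number of uses of control u under `θ`.

The N_u do not depend on `θ'` and add up to E[τ], so q_u = N_u / E[τ] is admissible in the supremum
defining D*. Dividing by E[τ] and taking the infimum over `θ'` gives d(α‖1-α) / E[τ] ≤ D*(θ). The
asymptotic claim follows from d(α‖1-α) ~ |log α|. -/

namespace ControlledSensing

/-! ### Measures on a σ-algebra enlarged by one variable -/

section Generic

variable {Ω : Type*} {m m0 : MeasurableSpace Ω}

lemma measure_eq_sum_inter_preimage {β : Type*} [Fintype β] [MeasurableSpace β]
    [MeasurableSingletonClass β] (μ : Measure Ω) {V : Ω → β} (hV : Measurable V) (A : Set Ω) :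
    μ A = ∑ b, μ (A ∩ V ⁻¹' {b}) := by
  have h := sum_measure_preimage_singleton (μ := μ.restrict A) (f := V) Finset.univ
    (fun b _ => hV (measurableSet_singleton b))
  simp only [Finset.coe_univ, Set.preimage_univ, Measure.restrict_apply_univ] at h
  rw [← h]
  refine Finset.sum_congr rfl fun b _ => ?_
  rw [Measure.restrict_apply (hV (measurableSet_singleton b)), Set.inter_comm]

/-- Two finite measures that agree on the sets `A ∩ Y ⁻¹' C` with `A` in `m` agree on the
σ-algebra generated by `m` and `Y`. -/
lemma measure_eq_of_eq_on_inter_preimage {β : Type*} [mβ : MeasurableSpace β] {Y : Ω → β}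
    (hm : m ≤ m0) (hY : Measurable Y) (μ ν : Measure[m0] Ω) [IsFiniteMeasure μ]
    (h : ∀ A, MeasurableSet[m] A → ∀ C, MeasurableSet C → μ (A ∩ Y ⁻¹' C) = ν (A ∩ Y ⁻¹' C))
    {D : Set Ω} (hD : MeasurableSet[m ⊔ mβ.comap Y] D) : μ D = ν D := by
  have hle : m ⊔ mβ.comap Y ≤ m0 := sup_le hm hY.comap_le
  set 𝒞 : Set (Set Ω) := {s | ∃ A C, MeasurableSet[m] A ∧ MeasurableSet C ∧ s = A ∩ Y ⁻¹' C}
   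
  have hgen : m ⊔ mβ.comap Y = MeasurableSpace.generateFrom 𝒞 := by
    apply le_antisymm
    · refine sup_le (fun A hA => ?_) ?_
      · exact MeasurableSpace.measurableSet_generateFrom ⟨A, Set.univ, hA, .univ, by simp⟩
      · rintro _ ⟨C, hC, rfl⟩
        exact MeasurableSpace.measurableSet_generateFrom ⟨Set.univ, C, .univ, hC, by simp⟩
    · refine MeasurableSpace.generateFrom_le ?_
      rintro _ ⟨A, C, hA, hC, rfl⟩
      exact MeasurableSet.inter ((le_sup_left : m ≤ m ⊔ mβ.comap Y) _ hA)
        ((le_sup_right : mβ.comap Y ≤ m ⊔ mβ.comap Y) _ ⟨C, hC, rfl⟩)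
  have hpi : IsPiSystem 𝒞 := by
    rintro _ ⟨A, C, hA, hC, rfl⟩ _ ⟨A', C', hA', hC', rfl⟩ _
    refine ⟨A ∩ A', C ∩ C', hA.inter hA', hC.inter hC', ?_⟩
    rw [Set.preimage_inter, Set.inter_inter_inter_comm]
  have htrim : μ.trim hle = ν.trim hle := by
    refine ext_of_generate_finite 𝒞 hgen hpi ?_ ?_
    · rintro s hs
      have hs' : MeasurableSet[m ⊔ mβ.comap Y] s := by
        rw [hgen]; exact MeasurableSpace.measurableSet_generateFrom hs
      rw [trim_measurableSet_eq hle hs', trim_measurableSet_eq hle hs']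
      obtain ⟨A, C, hA, hC, rfl⟩ := hs
      exact h A hA C hC
    · rw [trim_measurableSet_eq hle .univ, trim_measurableSet_eq hle .univ]
      simpa using h Set.univ .univ Set.univ .univ
  rw [← trim_measurableSet_eq hle hD, htrim, trim_measurableSet_eq hle hD]

lemma map_restrict_eq_smul {β : Type*} [MeasurableSpace β] {Y : Ω → β} (hY : Measurable Y)
    {μ : Measure[m0] Ω} {ν : Measure β} {A : Set Ω}
    (h : ∀ C, MeasurableSet C → μ (A ∩ Y ⁻¹' C) = μ A * ν C) :
    (μ.restrict A).map Y = μ A • ν := by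
  ext C hC
  rw [Measure.map_apply hY hC, Measure.restrict_apply (hY hC), Set.inter_comm, h C hC]
  simp

/-- If on the event `B` the variable `Y` is independent of `m` with law `ν`, then the expectation
of a product factorizes on `B`. -/
lemma setLIntegral_mul_comp_eq {β : Type*} [MeasurableSpace β] {Y : Ω → β} (hm : m ≤ m0)
    (hY : Measurable Y) {μ : Measure[m0] Ω} {ν : Measure β} {B : Set Ω} (hB : MeasurableSet[m] B)
    (h : ∀ A, MeasurableSet[m] A → A ⊆ B → ∀ C, MeasurableSet C →
      μ (A ∩ Y ⁻¹' C) = μ A * ν C)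
    {f : Ω → ℝ≥0∞} (hf : Measurable[m] f) {g : β → ℝ≥0∞} (hg : Measurable g) :
    ∫⁻ ω in B, f ω * g (Y ω) ∂μ = (∫⁻ ω in B, f ω ∂μ) * ∫⁻ y, g y ∂ν := by
  have hgY : Measurable (fun ω => g (Y ω)) := hg.comp hY
  -- Seen from `m` alone, weighting by `g (Y ω)` on `B` only multiplies the measure by the constant
  -- `∫ g dν`.
  have key : ((μ.restrict B).withDensity (fun ω => g (Y ω))).trim hm
      = (∫⁻ y, g y ∂ν) • (μ.restrict B).trim hm := by
    refine @Measure.ext _ m _ _ fun A hA => ?_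
    rw [trim_measurableSet_eq hm hA, withDensity_apply _ (hm _ hA), Measure.smul_apply,
      trim_measurableSet_eq hm hA, Measure.restrict_restrict (hm _ hA),
      Measure.restrict_apply (hm _ hA), ← lintegral_map hg hY,
      map_restrict_eq_smul hY (h _ (hA.inter hB) Set.inter_subset_right), lintegral_smul_measure,
      smul_eq_mul, smul_eq_mul, mul_comm]
  calc ∫⁻ ω in B, f ω * g (Y ω) ∂μ
      = ∫⁻ ω, f ω ∂((μ.restrict B).withDensity (fun ω => g (Y ω))) := by
        rw [lintegral_withDensity_eq_lintegral_mul _ hgY (hf.mono hm le_rfl)]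
        simp [mul_comm]
    _ = _ := by
        rw [← lintegral_trim hm hf, key, lintegral_smul_measure, lintegral_trim hm hf, smul_eq_mul,
          mul_comm]

end Generic

/-! ### Change of measure at a fixed time -/

section Controlled

variable {K : ℕ} {Ω : Type*} [mΩ : MeasurableSpace Ω] {U : ℕ → Ω → Fin K} {Y : ℕ → Ω → ℝ}
  {hU : ∀ k, Measurable (U k)} {hY : ∀ k, Measurable (Y k)}

/-- Under `P`, whatever happened before, an observation made with control `u` has law `ν u`. -/
def HasObsLaw (hU : ∀ k, Measurable (U k)) (hY : ∀ k, Measurable (Y k)) (P : Measure Ω)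
    (ν : Fin K → Measure ℝ) : Prop :=
  ∀ n u A, MeasurableSet[history U Y hU hY n] A → A ⊆ U n ⁻¹' {u} →
    ∀ C, MeasurableSet C → P (A ∩ Y n ⁻¹' C) = P A * ν u C

/-- The sum of the increments `f u y` over the first `n` steps. -/
def cumulative (U : ℕ → Ω → Fin K) (Y : ℕ → Ω → ℝ) (f : Fin K → ℝ → ℝ) (n : ℕ) (ω : Ω) : ℝ :=
  ∑ k ∈ Finset.range n, f (U k ω) (Y k ω)

lemma history_zero : history U Y hU hY 0 = ⊥ := by
  simp [history]

lemma measurable_history_control {k n : ℕ} (h : k < n) :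
    Measurable[history U Y hU hY n] (U k) :=
  Measurable.of_comap_le <| le_trans le_sup_left
    (le_iSup₂_of_le (f := fun k (_ : k < n) => MeasurableSpace.comap (U k) inferInstance ⊔
      MeasurableSpace.comap (Y k) inferInstance) k h le_rfl)

lemma measurable_history_obs {k n : ℕ} (h : k < n) :
    Measurable[history U Y hU hY n] (Y k) :=
  Measurable.of_comap_le <| le_trans le_sup_right
    (le_iSup₂_of_le (f := fun k (_ : k < n) => MeasurableSpace.comap (U k) inferInstance ⊔
      MeasurableSpace.comap (Y k) inferInstance) k h le_rfl)

/-- The control of step `n` is already a function of the past, so `Y n` is the only new information.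
-/
lemma history_succ_le (hpred : ∀ k, Measurable[history U Y hU hY k] (U k)) (n : ℕ) :
    history U Y hU hY (n + 1)
      ≤ history U Y hU hY n ⊔ MeasurableSpace.comap (Y n) inferInstance := by
  refine iSup₂_le fun k hk => ?_
  rcases Nat.lt_succ_iff_lt_or_eq.mp hk with h | rfl
  · exact le_sup_of_le_left <| sup_le (measurable_history_control h).comap_le
      (measurable_history_obs h).comap_le
  · exact sup_le_sup_right (hpred k).comap_le _

lemma measurable_uncurry_increment {f : Fin K → ℝ → ℝ} (hf : ∀ u, Measurable (f u)) :
    Measurable (fun p : Fin K × ℝ => f p.1 p.2) :=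
  measurable_from_prod_countable_right hf

lemma measurable_history_cumulative {f : Fin K → ℝ → ℝ} (hf : ∀ u, Measurable (f u)) (n : ℕ) :
    Measurable[history U Y hU hY n] (cumulative U Y f n) := by
  unfold cumulative
  refine Finset.measurable_fun_sum _ fun k hk => ?_
  have hk' := Finset.mem_range.mp hk
  exact (measurable_uncurry_increment hf).comp
    ((measurable_history_control hk').prodMk (measurable_history_obs hk'))

/-- Change of measure on the history up to a fixed time. -/
lemma measure_eq_setLIntegral_exp (hpred : ∀ k, Measurable[history U Y hU hY k] (U k))
    {P P' : Measure Ω} [IsProbabilityMeasure P] [IsProbabilityMeasure P']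
    {ν ν' : Fin K → Measure ℝ} {f : Fin K → ℝ → ℝ} (hf : ∀ u, Measurable (f u))
    (hν : ∀ u, ν' u = (ν u).withDensity fun y => ENNReal.ofReal (Real.exp (-f u y)))
    (hP : HasObsLaw hU hY P ν) (hP' : HasObsLaw hU hY P' ν') (n : ℕ) {A : Set Ω}
    (hA : MeasurableSet[history U Y hU hY n] A) :
    P' A = ∫⁻ ω in A, ENNReal.ofReal (Real.exp (-cumulative U Y f n ω)) ∂P := by
  induction n generalizing A with
  | zero =>
    rw [history_zero, MeasurableSpace.measurableSet_bot_iff] at hA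
    rcases hA with rfl | rfl <;> simp [cumulative]
  | succ n ih =>
    have hle := (history U Y hU hY).le
    rw [← withDensity_apply _ (hle _ _ hA)]
    refine measure_eq_of_eq_on_inter_preimage (hle n) (hY n) P' _ ?_
      (history_succ_le hpred n _ hA)
    intro A hA C hC
    -- The observation has a fixed law only once the control is fixed, hence the split over the
    -- values of `U n`.
    rw [measure_eq_sum_inter_preimage P' (hU n), measure_eq_sum_inter_preimage _ (hU n)]
    refine Finset.sum_congr rfl fun u _ => ?_
    rw [Set.inter_right_comm]
    have hA' := hA.inter (hpred n (measurableSet_singleton u))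
    have hsub : A ∩ U n ⁻¹' {u} ⊆ U n ⁻¹' {u} := Set.inter_subset_right
    generalize A ∩ U n ⁻¹' {u} = B at hA' hsub
    have hg : Measurable fun y => ENNReal.ofReal (Real.exp (-f u y)) :=
      (hf u).neg.exp.ennreal_ofReal
    rw [hP' n u B hA' hsub C hC, ih hA', hν u, withDensity_apply _ hC,
      withDensity_apply _ ((hle n _ hA').inter (hY n hC)), ← lintegral_indicator hC,
      ← setLIntegral_mul_comp_eq (hle n) (hY n) hA'
        (fun A hA hAB C hC => hP n u A hA (hAB.trans hsub) C hC)
        (f := fun ω => ENNReal.ofReal (Real.exp (-cumulative U Y f n ω)))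
        (measurable_history_cumulative hf n).neg.exp.ennreal_ofReal (hg.indicator hC),
      Set.inter_comm, ← Measure.restrict_restrict (hY n hC), ← lintegral_indicator (hY n hC)]
    refine setLIntegral_congr_fun (hle n _ hA') fun ω hω => ?_
    have hu : U n ω = u := hsub hω
    by_cases hC' : Y n ω ∈ C
    · simp only [hC', Set.indicator_of_mem, Set.mem_preimage, cumulative,
        Finset.sum_range_succ, neg_add, Real.exp_add, hu]
      rw [ENNReal.ofReal_mul (Real.exp_pos _).le]
    · simp [hC']

end Controlled

/-! ### Wald's identity and change of measure at a stopping time -/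

/-- Wald's identity for a series of variables `g (Y k)` on events `E k`, on each of which `Y k` has
law `ν`. -/
lemma integral_tsum_indicator_comp {Ω β : Type*} [MeasurableSpace Ω] [MeasurableSpace β]
    {P : Measure Ω} {ν : Measure β} {E : ℕ → Set Ω} (hE : ∀ k, MeasurableSet (E k))
    {Y : ℕ → Ω → β} (hY : ∀ k, Measurable (Y k))
    (hlaw : ∀ k, (P.restrict (E k)).map (Y k) = P (E k) • ν) {g : β → ℝ} (hg : Measurable g)
    (hfin : ∑' k, P (E k) ≠ ∞) (hint : ∑' k, P (E k) = 0 ∨ Integrable g ν) :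
    Integrable (fun ω => ∑' k, (E k).indicator (fun ω => g (Y k ω)) ω) P ∧
      ∫ ω, ∑' k, (E k).indicator (fun ω => g (Y k ω)) ω ∂P
        = (∑' k, P (E k)).toReal * ∫ y, g y ∂ν := by
  have hF : ∀ k, Measurable ((E k).indicator (fun ω => g (Y k ω))) :=
    fun k => (hg.comp (hY k)).indicator (hE k)
  have hnorm : ∀ k, ∫⁻ ω, ‖(E k).indicator (fun ω => g (Y k ω)) ω‖ₑ ∂P
      = P (E k) * ∫⁻ y, ‖g y‖ₑ ∂ν := by
    intro k
    simp_rw [enorm_indicator_eq_indicator_enorm]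
    rw [lintegral_indicator (hE k), ← lintegral_map (f := fun y => ‖g y‖ₑ) hg.enorm (hY k), hlaw,
      lintegral_smul_measure, smul_eq_mul]
  have hsum : ∑' k, ∫⁻ ω, ‖(E k).indicator (fun ω => g (Y k ω)) ω‖ₑ ∂P ≠ ∞ := by
    simp_rw [hnorm]
    rw [ENNReal.tsum_mul_right]
    -- If the events are null, `g` need not be integrable, since 0 * ∞ = 0. This later admits
    -- controls that are never used and have infinite divergence.
    rcases hint with h | h
    · simp [h]
    · exact ENNReal.mul_ne_top hfin h.2.ne
  refine ⟨⟨(Measurable.tsum hF).aestronglyMeasurable, ?_⟩, ?_⟩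
  · refine lt_of_le_of_lt (lintegral_mono fun ω => enorm_tsum_le_tsum_enorm) ?_
    rw [lintegral_tsum fun k => (hF k).enorm.aemeasurable]
    exact hsum.lt_top
  · rw [integral_tsum (fun k => (hF k).aestronglyMeasurable) hsum,
      ENNReal.tsum_toReal_eq (ENNReal.ne_top_of_tsum_ne_top hfin), ← tsum_mul_right]
    refine tsum_congr fun k => ?_
    rw [integral_indicator (hE k), ← integral_map (f := g) (hY k).aemeasurable
      hg.aestronglyMeasurable, hlaw, integral_smul_measure, smul_eq_mul]

section Stopped

variable {K : ℕ} {Ω : Type*} [mΩ : MeasurableSpace Ω] {U : ℕ → Ω → Fin K} {Y : ℕ → Ω → ℝ}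
  {hU : ∀ k, Measurable (U k)} {hY : ∀ k, Measurable (Y k)} {τ : Ω → ℕ∞}

/-- The event that control `u` is used in step `k`, before time `τ`. -/
def usedAt (U : ℕ → Ω → Fin K) (τ : Ω → ℕ∞) (u : Fin K) (k : ℕ) : Set Ω :=
  {ω | (k : ℕ∞) < τ ω} ∩ U k ⁻¹' {u}

/-- The expected number of times control `u` is used before time `τ`. -/
noncomputable def expectedUses (U : ℕ → Ω → Fin K) (τ : Ω → ℕ∞) (P : Measure Ω) (u : Fin K) :
    ℝ≥0∞ :=
  ∑' k, P (usedAt U τ u k)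

lemma measurableSet_history_lt (hτ : IsStoppingTime (history U Y hU hY) τ) (k : ℕ) :
    MeasurableSet[history U Y hU hY k] {ω | (k : ℕ∞) < τ ω} :=
  hτ.measurableSet_gt k

lemma measurableSet_history_usedAt (hpred : ∀ k, Measurable[history U Y hU hY k] (U k))
    (hτ : IsStoppingTime (history U Y hU hY) τ) (u : Fin K) (k : ℕ) :
    MeasurableSet[history U Y hU hY k] (usedAt U τ u k) :=
  (measurableSet_history_lt hτ k).inter (hpred k (measurableSet_singleton u))

lemma tsum_indicator_lt (t : ℕ∞) :
    ∑' k : ℕ, {k : ℕ | (k : ℕ∞) < t}.indicator (fun _ => (1 : ℝ≥0∞)) k = t := by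
  induction t using ENat.recTopCoe with
  | top => simp
  | coe n =>
    rw [tsum_eq_sum (s := Finset.range n) fun k hk => by simpa using hk]
    rw [Finset.sum_congr rfl fun k hk => Set.indicator_of_mem (by simpa using hk) _]
    simp

/-- Tonelli applied to τ = ∑ 1{k < τ}, each event being split by the control in use. -/
lemma sum_expectedUses (hτ : IsStoppingTime (history U Y hU hY) τ) (P : Measure Ω) :
    ∑ u, expectedUses U τ P u = ∫⁻ ω, (τ ω : ℝ≥0∞) ∂P := by
  have hmeas : ∀ k : ℕ, MeasurableSet {ω | (k : ℕ∞) < τ ω} :=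
    fun k => (history U Y hU hY).le k _ (measurableSet_history_lt hτ k)
  have h1 : ∀ ω, (τ ω : ℝ≥0∞)
      = ∑' k : ℕ, {ω | (k : ℕ∞) < τ ω}.indicator (fun _ => (1 : ℝ≥0∞)) ω :=
    fun ω => (tsum_indicator_lt (τ ω)).symm
  simp_rw [h1]
  rw [lintegral_tsum fun k => (measurable_const.indicator (hmeas k)).aemeasurable]
  unfold expectedUses
  rw [← Summable.tsum_finsetSum fun _ _ => ENNReal.summable]
  refine tsum_congr fun k => ?_
  rw [lintegral_indicator (hmeas k), setLIntegral_const, one_mul,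
    measure_eq_sum_inter_preimage P (hU k) {ω | (k : ℕ∞) < τ ω}]
  rfl

omit mΩ in
/-- The sum of the increments up to a finite stopping time, sorted by control. -/
lemma cumulative_toNat_eq {f : Fin K → ℝ → ℝ} {ω : Ω} (h : τ ω < ⊤) :
    cumulative U Y f (τ ω).toNat ω
      = ∑ u, ∑' k, (usedAt U τ u k).indicator (fun ω => f u (Y k ω)) ω := by
  classical
  obtain ⟨n, hn⟩ := ENat.ne_top_iff_exists.mp h.ne
  have h0 : ∀ u, ∑' k, (usedAt U τ u k).indicator (fun ω => f u (Y k ω)) ω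
      = ∑ k ∈ Finset.range n, if U k ω = u then f u (Y k ω) else 0 := by
    intro u
    rw [tsum_eq_sum (s := Finset.range n)]
    · refine Finset.sum_congr rfl fun k hk => ?_
      have : (k : ℕ∞) < τ ω := by rw [← hn]; exact_mod_cast Finset.mem_range.mp hk
      simp [Set.indicator_apply, usedAt, this]
    · intro k hk
      refine Set.indicator_of_notMem (fun hmem => hk ?_) _
      have : (k : ℕ∞) < τ ω := hmem.1
      rw [← hn] at this
      exact Finset.mem_range.mpr (by exact_mod_cast this)
  simp_rw [h0]
  rw [Finset.sum_comm, ← hn]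
  simp [cumulative]

lemma ae_lt_top_of_measure_eq_one {P : Measure Ω} [IsProbabilityMeasure P]
    (hτ : IsStoppingTime (history U Y hU hY) τ) (h : P {ω | τ ω < ⊤} = 1) :
    ∀ᵐ ω ∂P, τ ω < ⊤ := by
  have hm : MeasurableSet {ω | τ ω < ⊤} := by
    have : {ω | τ ω < ⊤} = ⋃ n : ℕ, {ω | (n : ℕ∞) < τ ω}ᶜ := by
      ext ω
      simp only [Set.mem_ofPred_eq, Set.mem_iUnion, Set.mem_compl_iff, not_lt]
      constructor
      · intro h
        obtain ⟨n, hn⟩ := ENat.ne_top_iff_exists.mp h.ne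
        exact ⟨n, hn.symm.le⟩
      · rintro ⟨n, hn⟩
        exact lt_of_le_of_lt hn (ENat.natCast_lt_top n)
    rw [this]
    exact .iUnion fun n => ((history U Y hU hY).le n _ (measurableSet_history_lt hτ n)).compl
  rw [ae_iff]
  exact (prob_compl_eq_zero_iff hm).mpr h

/-- Wald's identity for the sum of the increments up to a stopping time. -/
lemma integral_cumulative_toNat (hpred : ∀ k, Measurable[history U Y hU hY k] (U k))
    {P : Measure Ω} {ν : Fin K → Measure ℝ} {f : Fin K → ℝ → ℝ} (hf : ∀ u, Measurable (f u))
    (hP : HasObsLaw hU hY P ν) (hτ : IsStoppingTime (history U Y hU hY) τ)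
    (htop : ∀ᵐ ω ∂P, τ ω < ⊤) (hfin : ∀ u, expectedUses U τ P u ≠ ∞)
    (hint : ∀ u, expectedUses U τ P u = 0 ∨ Integrable (f u) (ν u)) :
    Integrable (fun ω => cumulative U Y f (τ ω).toNat ω) P ∧
      ∫ ω, cumulative U Y f (τ ω).toNat ω ∂P
        = ∑ u, (expectedUses U τ P u).toReal * ∫ y, f u y ∂ν u := by
  have hE := measurableSet_history_usedAt hpred hτ
  have h := fun u => integral_tsum_indicator_comp (P := P) (ν := ν u)
    (fun k => (history U Y hU hY).le k _ (hE u k)) hY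
    (fun k => map_restrict_eq_smul (hY k) (hP k u _ (hE u k) Set.inter_subset_right)) (hf u)
    (hfin u) (hint u)
  have hae : (fun ω => cumulative U Y f (τ ω).toNat ω) =ᵐ[P]
      fun ω => ∑ u, ∑' k, (usedAt U τ u k).indicator (fun ω => f u (Y k ω)) ω := by
    filter_upwards [htop] with ω hω using cumulative_toNat_eq hω
  refine ⟨(integrable_congr hae).mpr (integrable_finsetSum _ fun u _ => (h u).1), ?_⟩
  rw [integral_congr_ae hae, integral_finsetSum _ fun u _ => (h u).1]
  exact Finset.sum_congr rfl fun u _ => (h u).2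

/-- Change of measure on the history up to a finite stopping time. -/
lemma measure_eq_setLIntegral_exp_stopped
    (hpred : ∀ k, Measurable[history U Y hU hY k] (U k))
    {P P' : Measure Ω} [IsProbabilityMeasure P] [IsProbabilityMeasure P']
    {ν ν' : Fin K → Measure ℝ} {f : Fin K → ℝ → ℝ} (hf : ∀ u, Measurable (f u))
    (hν : ∀ u, ν' u = (ν u).withDensity fun y => ENNReal.ofReal (Real.exp (-f u y)))
    (hP : HasObsLaw hU hY P ν) (hP' : HasObsLaw hU hY P' ν')
    (hτ : IsStoppingTime (history U Y hU hY) τ) (htop : ∀ᵐ ω ∂P, τ ω < ⊤)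
    (htop' : ∀ᵐ ω ∂P', τ ω < ⊤) {A : Set Ω} (hA : MeasurableSet[hτ.measurableSpace] A) :
    P' A = ∫⁻ ω in A, ENNReal.ofReal (Real.exp (-cumulative U Y f (τ ω).toNat ω)) ∂P := by
  set B : ℕ → Set Ω := fun n => A ∩ {ω | τ ω = n}
  -- On `τ = n` an event of the stopped σ-algebra belongs to the history at time `n`, where the
  -- fixed-time formula applies.
  have hBm : ∀ n, MeasurableSet[history U Y hU hY n] (B n) := fun n =>
    (hτ.measurableSet_inter_eq_iff A n).mp (hA.inter (hτ.measurableSet_eq' n))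
  have hB : ∀ n, MeasurableSet (B n) := fun n => (history U Y hU hY).le n _ (hBm n)
  have hdisj : Pairwise (Function.onFun Disjoint B) := by
    intro i j hij
    refine Set.disjoint_left.mpr fun ω hi hj => hij ?_
    exact_mod_cast (hi.2 : τ ω = i).symm.trans hj.2
  have hAB : ∀ Q : Measure Ω, (∀ᵐ ω ∂Q, τ ω < ⊤) → A =ᵐ[Q] ⋃ n, B n := by
    intro Q hQ
    filter_upwards [hQ] with ω hω
    obtain ⟨n, hn⟩ := ENat.ne_top_iff_exists.mp hω.ne
    refine propext ⟨fun h => Set.mem_iUnion.mpr ⟨n, h, hn.symm⟩, fun h => ?_⟩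
    obtain ⟨_, h⟩ := Set.mem_iUnion.mp h
    exact h.1
  rw [measure_congr (hAB P' htop'), setLIntegral_congr (hAB P htop),
    measure_iUnion hdisj hB, lintegral_iUnion hB hdisj]
  refine tsum_congr fun n => ?_
  rw [measure_eq_setLIntegral_exp hpred hf hν hP hP' n (hBm n)]
  refine setLIntegral_congr_fun (hB n) fun ω hω => ?_
  have : τ ω = n := hω.2
  simp [this]

end Stopped

/-! ### From error probabilities to relative entropy -/

/-- Data processing: if the likelihood ratio `exp (-W)` turns an event of probability at most `α`
into one of probability at least `1 - α`, then `W` has mean at least `d (α ‖ 1 - α)`. -/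
lemma binaryRelEntropy_le_integral {Ω : Type*} [MeasurableSpace Ω] {P P' : Measure Ω}
    [IsProbabilityMeasure P] [IsProbabilityMeasure P'] {W : Ω → ℝ} (hW : Integrable W P)
    {A : Set Ω} (hA : MeasurableSet A)
    (hPA : P' A = ∫⁻ ω in A, ENNReal.ofReal (Real.exp (-W ω)) ∂P)
    (hPAc : P' Aᶜ = ∫⁻ ω in Aᶜ, ENNReal.ofReal (Real.exp (-W ω)) ∂P)
    {α : ℝ} (h0 : 0 < α) (h1 : α ≤ 1 / 2) (hα : P.real A ≤ α) (hα' : P'.real Aᶜ ≤ α) :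
    binaryRelEntropy α (1 - α) ≤ ∫ ω, W ω ∂P := by
  have hmeas : AEStronglyMeasurable (fun ω => Real.exp (-W ω)) P :=
    Real.continuous_exp.comp_aestronglyMeasurable hW.1.neg
  have hint : ∀ B, P' B = ∫⁻ ω in B, ENNReal.ofReal (Real.exp (-W ω)) ∂P →
      IntegrableOn (fun ω => Real.exp (-W ω)) B P ∧
        ∫ ω in B, Real.exp (-W ω) ∂P = P'.real B := by
    intro B hB
    refine ⟨⟨hmeas.restrict, ?_⟩, ?_⟩
    · rw [hasFiniteIntegral_iff_ofReal (ae_of_all _ fun ω => (Real.exp_pos _).le), ← hB]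
      exact measure_lt_top _ _
    · rw [integral_eq_lintegral_of_nonneg_ae (ae_of_all _ fun ω => (Real.exp_pos _).le)
        hmeas.restrict, ← hB, measureReal_def]
  have hbound : ∀ B, MeasurableSet B →
      P' B = ∫⁻ ω in B, ENNReal.ofReal (Real.exp (-W ω)) ∂P → ∀ s : ℝ, 0 < s →
      (1 + Real.log s) * P.real B - s * P'.real B ≤ ∫ ω in B, W ω ∂P := by
    intro B hBm hB s hs
    obtain ⟨hi, he⟩ := hint B hB
    have h : ∫ ω in B, ((1 + Real.log s) - s * Real.exp (-W ω)) ∂P ≤ ∫ ω in B, W ω ∂P := by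
      refine integral_mono ((integrable_const _).sub (hi.const_mul s)) hW.integrableOn ?_
      intro ω
      -- The tangent bound 1 + x ≤ exp x at x = log s - W gives W ≥ 1 + log s - s exp(-W), with `s`
      -- free.
      have := Real.add_one_le_exp (Real.log s + -W ω)
      rw [Real.exp_add, Real.exp_log hs] at this
      dsimp only
      linarith
    rw [integral_sub (integrable_const _) (hi.const_mul s), integral_const_mul, he] at h
    simpa [mul_comm] using h
  have hα1 : 0 < 1 - α := by linarith
  -- The bound on a set is sharpest when `s` is the ratio of its probabilities under `P` and `P'`.
  -- In the extremal case this is α / (1 - α) on `A` and its inverse on `Aᶜ`.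
  set s := α / (1 - α) with hs
  have hs0 : 0 < s := div_pos h0 hα1
  have hsle : s ≤ 1 := by rw [hs, div_le_one hα1]; linarith
  have hlog : Real.log s ≤ 0 := Real.log_nonpos hs0.le hsle
  have hb1 := hbound A hA hPA s hs0
  have hb2 := hbound Aᶜ hA.compl hPAc s⁻¹ (inv_pos.mpr hs0)
  rw [Real.log_inv] at hb2
  have hsum := integral_add_compl hA hW
  have hp : P.real Aᶜ = 1 - P.real A := probReal_compl_eq_one_sub hA
  have hp' : P'.real A = 1 - P'.real Aᶜ := by rw [probReal_compl_eq_one_sub hA]; ring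
  have hd : binaryRelEntropy α (1 - α) = -(1 - 2 * α) * Real.log s := by
    have : (1 - α) / (1 - (1 - α)) = s⁻¹ := by rw [hs, inv_div]; ring_nf
    rw [binaryRelEntropy, this, Real.log_inv]
    ring
  have hsα : s * (1 - α) = α := div_mul_cancel₀ _ hα1.ne'
  have hsinv : s⁻¹ * α = 1 - α := by rw [hs, inv_div, div_mul_cancel₀ _ h0.ne']
  -- The two bounds add up to an expression nonincreasing in both error probabilities. Replacing
  -- each by `α` leaves exactly d(α‖1-α).
  have hmono : (s⁻¹ - s) * P'.real Aᶜ ≤ (s⁻¹ - s) * α := by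
    refine mul_le_mul_of_nonneg_left hα' ?_
    have := (one_le_inv₀ hs0).mpr hsle
    linarith
  have hmono' : Real.log s * (α - P.real A) ≤ 0 :=
    mul_nonpos_of_nonpos_of_nonneg hlog (by linarith)
  rw [hp] at hb2
  rw [hp'] at hb1
  rw [hd]
  nlinarith

/-! ### Likelihood ratios in the exponential families -/

namespace Problem

variable {K M : ℕ} (S : Problem K M) {θ θ' : Fin K → ℝ}

lemma mem_parameters_of_mem_states (hθ : θ ∈ S.states) (u : Fin K) : θ u ∈ S.Ψ u := by
  obtain ⟨m, hm⟩ := Set.mem_iUnion.mp hθ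
  exact S.Θ_subset m hm u (Set.mem_univ u)

lemma measurable_density (θ : Fin K → ℝ) (u : Fin K) : Measurable (S.density θ u) :=
  (S.measurable_h u).mul (((S.measurable_T u).const_mul _).sub_const _).exp

lemma isProbabilityMeasure_obsLaw (hθ : θ ∈ S.states) (u : Fin K) :
    IsProbabilityMeasure (S.obsLaw θ u) := by
  have hΨ := S.mem_parameters_of_mem_states hθ u
  have hpos := S.integral_exp_pos u _ hΨ
  have hd : S.density θ u = fun y => S.h u y * Real.exp (θ u * S.T u y) /
      ∫ y, S.h u y * Real.exp (θ u * S.T u y) ∂S.base := by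
    funext y
    rw [density, logPartition, Real.exp_sub, Real.exp_log hpos, mul_div_assoc]
  constructor
  rw [obsLaw, withDensity_apply _ .univ, Measure.restrict_univ,
    ← ofReal_integral_eq_lintegral_ofReal, hd, integral_div, div_self hpos.ne', ENNReal.ofReal_one]
  · rw [hd]
    exact (S.integrable_exp u _ hΨ).div_const _
  · exact ae_of_all _ fun y => mul_nonneg (S.h_nonneg u y) (Real.exp_pos _).le

/-- The log-likelihood ratio of `θ` against `θ'` of an observation under control `u`. -/
noncomputable def logRatio (θ θ' : Fin K → ℝ) (u : Fin K) (y : ℝ) : ℝ :=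
  (θ u * S.T u y - S.logPartition u (θ u)) - (θ' u * S.T u y - S.logPartition u (θ' u))

lemma measurable_logRatio (θ θ' : Fin K → ℝ) (u : Fin K) : Measurable (S.logRatio θ θ' u) :=
  (((S.measurable_T u).const_mul _).sub_const _).sub
    (((S.measurable_T u).const_mul _).sub_const _)

lemma measurable_exp_neg_logRatio (θ θ' : Fin K → ℝ) (u : Fin K) :
    Measurable fun y => ENNReal.ofReal (Real.exp (-S.logRatio θ θ' u y)) :=
  (S.measurable_logRatio θ θ' u).neg.exp.ennreal_ofReal

/-- Both densities share the carrier `h`, so their quotient is a pure exponential, and both vanish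
where `h` does. The laws are therefore mutually absolutely continuous. -/
lemma obsLaw_eq_withDensity (θ θ' : Fin K → ℝ) (u : Fin K) :
    S.obsLaw θ' u = (S.obsLaw θ u).withDensity
      fun y => ENNReal.ofReal (Real.exp (-S.logRatio θ θ' u y)) := by
  rw [obsLaw, obsLaw, ← withDensity_mul _ (S.measurable_density θ u).ennreal_ofReal
    (S.measurable_exp_neg_logRatio θ θ' u)]
  congr 1
  funext y
  rw [Pi.mul_apply, density, density,
    ← ENNReal.ofReal_mul (mul_nonneg (S.h_nonneg u y) (Real.exp_pos _).le), mul_assoc,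
    ← Real.exp_add, logRatio]
  congr 3
  ring_nf

lemma obsLaw_absolutelyContinuous (θ θ' : Fin K → ℝ) (u : Fin K) :
    S.obsLaw θ u ≪ S.obsLaw θ' u := by
  rw [S.obsLaw_eq_withDensity θ' θ u]
  exact withDensity_absolutelyContinuous _ _

lemma llr_obsLaw_ae_eq (hθ' : θ' ∈ S.states) (θ : Fin K → ℝ) (u : Fin K) :
    llr (S.obsLaw θ u) (S.obsLaw θ' u) =ᵐ[S.obsLaw θ u] S.logRatio θ θ' u := by
  have := S.isProbabilityMeasure_obsLaw hθ' u
  have h := Measure.rnDeriv_withDensity (S.obsLaw θ' u)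
    (S.measurable_exp_neg_logRatio θ' θ u)
  rw [← S.obsLaw_eq_withDensity θ' θ u] at h
  filter_upwards [S.obsLaw_absolutelyContinuous θ θ' u h] with y hy
  rw [llr, hy, ENNReal.toReal_ofReal (Real.exp_pos _).le, Real.log_exp, logRatio, logRatio]
  ring

lemma integrable_logRatio (hθ' : θ' ∈ S.states) {u : Fin K} (h : S.divergence u θ θ' ≠ ∞) :
    Integrable (S.logRatio θ θ' u) (S.obsLaw θ u) :=
  (integrable_congr (S.llr_obsLaw_ae_eq hθ' θ u)).mp
    (InformationTheory.klDiv_ne_top_iff.mp h).2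

/-- The laws have equal mass, so `klDiv` carries no correction term. If the divergence is infinite,
both sides are 0 by convention. -/
lemma toReal_divergence (hθ : θ ∈ S.states) (hθ' : θ' ∈ S.states) (u : Fin K) :
    (S.divergence u θ θ').toReal = ∫ y, S.logRatio θ θ' u y ∂S.obsLaw θ u := by
  have := S.isProbabilityMeasure_obsLaw hθ u
  have := S.isProbabilityMeasure_obsLaw hθ' u
  rw [divergence, InformationTheory.toReal_klDiv_of_measure_eq
    (S.obsLaw_absolutelyContinuous θ θ' u) (by simp)]
  exact integral_congr_ae (S.llr_obsLaw_ae_eq hθ' θ u)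

end Problem

/-! ### The transportation inequality and the lower bound -/

namespace Policy

variable {K M : ℕ} {S : Problem K M} (φ : Policy S) {θ θ' : Fin K → ℝ}

instance : MeasurableSpace φ.Ω := φ.mΩ

/-- Integrate the conditional law over `A`, on which the control, and hence that law, is constant.
-/
lemma hasObsLaw (hθ : θ ∈ S.states) :
    HasObsLaw φ.measurable_U φ.measurable_Y (φ.prob θ) (S.obsLaw θ) := by
  have := φ.isProb θ hθ
  intro n u A hA hAu C hC
  have := S.isProbabilityMeasure_obsLaw hθ u
  have hle := (history φ.U φ.Y φ.measurable_U φ.measurable_Y).le n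
  have hYC : MeasurableSet (φ.Y n ⁻¹' C) := φ.measurable_Y n hC
  have h1 := setIntegral_condExp (μ := φ.prob θ) hle
    (f := (φ.Y n ⁻¹' C).indicator fun _ => (1 : ℝ)) ((integrable_const 1).indicator hYC) hA
  rw [setIntegral_congr_ae (g := fun _ => (S.obsLaw θ u).real C) (hle _ hA) ?_,
    setIntegral_indicator hYC] at h1
  · simp only [integral_const, MeasurableSet.univ, measureReal_restrict_apply, Set.univ_inter,
      smul_eq_mul, mul_one] at h1
    rw [← ENNReal.toReal_eq_toReal_iff' (measure_ne_top _ _)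
      (ENNReal.mul_ne_top (measure_ne_top _ _) (measure_ne_top _ _)), ENNReal.toReal_mul]
    exact h1.symm
  · filter_upwards [φ.law θ hθ n C hC] with ω hω hωA
    have hu : φ.U n ω = u := hAu hωA
    rw [hω, hu]

/-- The transportation inequality between the states `θ` and `θ'`. -/
lemma binaryRelEntropy_le_sum_expectedUses_mul_divergence {α : ℝ} (h0 : 0 < α) (h1 : α ≤ 1 / 2)
    (hφ : φ.IsCorrect α) (hθ : θ ∈ S.states) (hθ' : θ' ∈ S.alternatives θ)
    (hfin : φ.expectedDelay θ ≠ ∞) :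
    ENNReal.ofReal (binaryRelEntropy α (1 - α))
      ≤ ∑ u, expectedUses φ.U φ.τ (φ.prob θ) u * S.divergence u θ θ' := by
  by_cases htop : ∑ u, expectedUses φ.U φ.τ (φ.prob θ) u * S.divergence u θ θ' = ∞
  · exact htop ▸ le_top
  have hP := φ.isProb θ hθ
  have hP' := φ.isProb θ' hθ'.1
  obtain ⟨m, hm⟩ := Set.mem_iUnion.mp hθ
  obtain ⟨m', hm'⟩ := Set.mem_iUnion.mp hθ'.1
  have hmm : m ≠ m' := fun h => hθ'.2 m hm (h ▸ hm')
  obtain ⟨hfinite, herr⟩ := hφ m θ hm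
  obtain ⟨hfinite', herr'⟩ := hφ m' θ' hm'
  have hτ := φ.isStoppingTime
  have hae := ae_lt_top_of_measure_eq_one hτ hfinite
  have hae' := ae_lt_top_of_measure_eq_one hτ hfinite'
  have hlaw := φ.hasObsLaw hθ
  have hlaw' := φ.hasObsLaw hθ'.1
  have hmeas := S.measurable_logRatio θ θ'
  have hdens := S.obsLaw_eq_withDensity θ θ'
  have huses : ∀ u, expectedUses φ.U φ.τ (φ.prob θ) u ≠ ∞ := by
    have hsum : ∑ u, expectedUses φ.U φ.τ (φ.prob θ) u ≠ ∞ := by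
      rw [sum_expectedUses hτ]; exact hfin
    exact fun u => (ENNReal.sum_ne_top.mp hsum) u (Finset.mem_univ u)
  have hterm : ∀ u, expectedUses φ.U φ.τ (φ.prob θ) u * S.divergence u θ θ' ≠ ∞ :=
    fun u => (ENNReal.sum_ne_top.mp htop) u (Finset.mem_univ u)
  have hint : ∀ u, expectedUses φ.U φ.τ (φ.prob θ) u = 0 ∨
      Integrable (S.logRatio θ θ' u) (S.obsLaw θ u) := by
    intro u
    refine or_iff_not_imp_left.mpr fun hne => S.integrable_logRatio hθ'.1 fun h => hterm u ?_
    rw [h, ENNReal.mul_top hne]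
  obtain ⟨hW, hWald⟩ :=
    integral_cumulative_toNat φ.predictable hmeas hlaw hτ hae huses hint
  -- This event is an error under `θ`. Its complement, deciding `m`, is an error under `θ'`.
  have hA : MeasurableSet[hτ.measurableSpace] {ω | φ.decision ω ≠ m} :=
    φ.measurable_decision (measurableSet_singleton m).compl
  have key := binaryRelEntropy_le_integral hW (hτ.measurableSpace_le _ hA)
    (measure_eq_setLIntegral_exp_stopped φ.predictable hmeas hdens hlaw hlaw' hτ hae hae' hA)
    (measure_eq_setLIntegral_exp_stopped φ.predictable hmeas hdens hlaw hlaw' hτ hae hae' hA.compl)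
    h0 h1 (ENNReal.toReal_le_of_le_ofReal h0.le herr)
    (ENNReal.toReal_le_of_le_ofReal h0.le <| le_trans (measure_mono fun ω hω => ?_) herr')
  · rw [hWald] at key
    refine (ENNReal.ofReal_le_ofReal key).trans ?_
    refine ENNReal.ofReal_le_of_le_toReal ?_
    rw [ENNReal.toReal_sum fun u _ => hterm u]
    refine Finset.sum_le_sum fun u _ => ?_
    rw [ENNReal.toReal_mul, S.toReal_divergence hθ hθ'.1]
  · have hωm : φ.decision ω = m := not_not.mp hω
    exact fun h => hmm (hωm.symm.trans h)

/-- The normalized expected uses serve as the distribution `q` in `Dstar`. -/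
lemma binaryRelEntropy_div_Dstar_le {α : ℝ} (h0 : 0 < α) (h1 : α ≤ 1 / 2)
    (hφ : φ.IsCorrect α) (hθ : θ ∈ S.states) :
    ENNReal.ofReal (binaryRelEntropy α (1 - α)) / S.Dstar θ ≤ φ.expectedDelay θ := by
  by_cases hfin : φ.expectedDelay θ = ∞
  · exact hfin ▸ le_top
  have htrans := fun θ' (hθ' : θ' ∈ S.alternatives θ) =>
    φ.binaryRelEntropy_le_sum_expectedUses_mul_divergence h0 h1 hφ hθ hθ' hfin
  have hsum : ∑ u, expectedUses φ.U φ.τ (φ.prob θ) u = φ.expectedDelay θ :=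
    sum_expectedUses φ.isStoppingTime _
  set N := expectedUses φ.U φ.τ (φ.prob θ)
  set d := ENNReal.ofReal (binaryRelEntropy α (1 - α))
  -- With zero delay there is nothing to normalize. Either no alternative exists and D* = ∞, or the
  -- transportation inequality forces d = 0; the quotient is 0 both times.
  by_cases hzero : φ.expectedDelay θ = 0
  · have hN : ∀ u, N u = 0 := by simpa [hzero] using hsum
    rcases (S.alternatives θ).eq_empty_or_nonempty with hempty | ⟨θ', hθ'⟩
    · have hK : Nonempty (Fin K) := by
        have := φ.isProb θ hθ
        exact ⟨φ.U 0 (nonempty_of_isProbabilityMeasure (φ.prob θ)).some⟩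
      have hD : S.Dstar θ = ∞ := by
        refine top_le_iff.mp ?_
        refine le_iSup₂_of_le _ (single_mem_stdSimplex ℝ hK.some) ?_
        simp [hempty]
      simp [hD, d]
    · have : d = 0 := by simpa [hN] using htrans θ' hθ'
      simp [this]
  have hN : ∀ u, N u / φ.expectedDelay θ ≠ ∞ := fun u => by
    refine ENNReal.div_ne_top ?_ hzero
    exact ne_top_of_le_ne_top hfin (hsum ▸ Finset.single_le_sum (fun _ _ => zero_le)
      (Finset.mem_univ u))
  have hq : (fun u => (N u / φ.expectedDelay θ).toReal) ∈ stdSimplex ℝ (Fin K) := by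
    refine ⟨fun u => ENNReal.toReal_nonneg, ?_⟩
    rw [← ENNReal.toReal_sum fun u _ => hN u]
    simp_rw [div_eq_mul_inv]
    rw [← Finset.sum_mul, hsum, ENNReal.mul_inv_cancel hzero hfin, ENNReal.toReal_one]
  have hle : d / φ.expectedDelay θ ≤ S.Dstar θ := by
    refine le_iSup₂_of_le _ hq (le_iInf₂ fun θ' hθ' => ?_)
    have hterm : ∀ u, ENNReal.ofReal (N u / φ.expectedDelay θ).toReal * S.divergence u θ θ'
        = N u * S.divergence u θ θ' * (φ.expectedDelay θ)⁻¹ := fun u => by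
      rw [ENNReal.ofReal_toReal (hN u), div_eq_mul_inv, mul_right_comm]
    simp_rw [hterm]
    rw [← Finset.sum_mul]
    exact ENNReal.div_le_div_right (htrans θ' hθ') _
  exact ENNReal.div_le_of_le_mul' ((ENNReal.div_le_iff hzero hfin).mp hle)

end Policy

/-! ### Asymptotics for small error probability -/

/-- For 0 < α < 1 the quotient equals (1 - 2α)(log(1-α) / (-log α) + 1). -/
lemma tendsto_binaryRelEntropy_div_abs_log :
    Tendsto (fun α : ℝ => binaryRelEntropy α (1 - α) / |Real.log α|) (𝓝[>] 0) (𝓝 1) := by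
  have h1 : Tendsto (fun α : ℝ => Real.log (1 - α) * (-Real.log α)⁻¹) (𝓝[>] 0) (𝓝 0) := by
    have ha : Tendsto (fun α : ℝ => Real.log (1 - α)) (𝓝[>] 0) (𝓝 0) := by
      have : ContinuousAt (fun α : ℝ => Real.log (1 - α)) 0 :=
        ContinuousAt.log (by fun_prop) (by norm_num)
      simpa [ContinuousAt] using this.tendsto.mono_left (nhdsWithin_le_nhds (s := Set.Ioi 0))
    have hb : Tendsto (fun α : ℝ => (-Real.log α)⁻¹) (𝓝[>] 0) (𝓝 0) :=
      (tendsto_neg_atBot_atTop.comp Real.tendsto_log_nhdsGT_zero).inv_tendsto_atTop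
    simpa using ha.mul hb
  have h2 : Tendsto (fun α : ℝ => 1 - 2 * α) (𝓝[>] 0) (𝓝 1) := by
    have : Tendsto (fun α : ℝ => 1 - 2 * α) (𝓝 0) (𝓝 (1 - 2 * 0)) :=
      Continuous.tendsto (by fun_prop) 0
    simpa using this.mono_left nhdsWithin_le_nhds
  have h3 := h2.mul (h1.add_const 1)
  simp only [zero_add, mul_one] at h3
  refine h3.congr' ?_
  filter_upwards [Ioo_mem_nhdsGT (show (0 : ℝ) < 1 by norm_num)] with α hα
  have hlog : Real.log α < 0 := Real.log_neg hα.1 hα.2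
  have h1α : (1 : ℝ) - α ≠ 0 := by linarith [hα.2]
  rw [abs_of_neg hlog, binaryRelEntropy, sub_sub_cancel, Real.log_div hα.1.ne' h1α,
    Real.log_div h1α hα.1.ne']
  field_simp [hlog.ne]
  ring

end ControlledSensing

theorem lemma1 {K M : ℕ} (S : ControlledSensing.Problem K M) (θ : Fin K → ℝ) (hθ : θ ∈ S.states) :
    (∀ α : ℝ, 0 < α → α ≤ 1 / 2 → ∀ φ : ControlledSensing.Policy S, φ.IsCorrect α →
      ENNReal.ofReal (ControlledSensing.binaryRelEntropy α (1 - α)) / S.Dstar θ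
        ≤ φ.expectedDelay θ) ∧
    (∀ φ : ℝ → ControlledSensing.Policy S, (∀ᶠ α in 𝓝[>] (0 : ℝ), (φ α).IsCorrect α) →
      1 / S.Dstar θ
        ≤ liminf (fun α : ℝ => (φ α).expectedDelay θ / ENNReal.ofReal |Real.log α|)
            (𝓝[>] (0 : ℝ))) := by
  refine ⟨fun α h0 h1 φ hφ => φ.binaryRelEntropy_div_Dstar_le h0 h1 hφ hθ, fun φ hφ => ?_⟩
  have hlim : Tendsto (fun α : ℝ => ENNReal.ofReal
      (ControlledSensing.binaryRelEntropy α (1 - α) / |Real.log α|) / S.Dstar θ)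
      (𝓝[>] (0 : ℝ)) (𝓝 (1 / S.Dstar θ)) := by
    have h := ENNReal.tendsto_ofReal ControlledSensing.tendsto_binaryRelEntropy_div_abs_log
    rw [ENNReal.ofReal_one] at h
    -- The limit 1 is nonzero, so the factor 1 / D* may be infinite; this covers D* = 0.
    exact ENNReal.Tendsto.mul_const h (Or.inl one_ne_zero)
  rw [← hlim.liminf_eq]
  refine liminf_le_liminf ?_
  filter_upwards [hφ, Ioo_mem_nhdsGT (show (0 : ℝ) < 1 / 2 by norm_num)] with α hα hα'
  have hlog : 0 < |Real.log α| :=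
    abs_pos.mpr (Real.log_neg hα'.1 (by linarith [hα'.2])).ne
  rw [ENNReal.ofReal_div_of_pos hlog, ENNReal.div_right_comm]
  exact ENNReal.div_le_div_right
    ((φ α).binaryRelEntropy_div_Dstar_le hα'.1 hα'.2.le hα hθ) _
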